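/- For integers $l\ge 1$ and $p,q\ge 2$, let $\theta(l,p,q)$ be the graph obtained from three vertex-disjoint paths with $l$, $p$ and $q$ edges, respectively, by identifying their three initial vertices into one vertex and their three terminal vertices into another. For a finite connected graph $G$ let $D(G)$ be its distance matrix, whose $(u,v)$ entry is the number of edges of a shortest path from $u$ to $v$, and for a square matrix $A$ let $\operatorname{cof} A$ denote the sum of all cofactors of $A$. Let $G$ be a finite graph isomorphic to some $\theta(l,p,q)$ with $l\ge 1$ and $p,q\ge 2$. Then: - if $G\cong\theta(1,p,q)$ for some even integers $p,q\ge 2$, then $\operatorname{cof} D(G)=-(p+q)$; - if $G\cong\theta(2,2,2)$, then $\operatorname{cof} D(G)=-16$; - if $G\cong\theta(2,2,q)$ for some odd integer $q>1$, then $\operatorname{cof} D(G)=4q-8$; - otherwise (that is, if $G$ is isomorphic to none of the graphs listed above), $\operatorname{cof} D(G)=0$. -/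

import Mathlib

/-- The distance matrix `D(G)` of a graph: its `(u, v)` entry is the number of edges of a shortest
path from `u` to `v`. -/
noncomputable def distMatrix {V : Type*} (G : SimpleGraph V) : Matrix V V ℤ :=
  Matrix.of fun u v => (G.dist u v : ℤ)

/-- The sum `cof A` of all the cofactors of a square matrix `A` (the adjugate is the transpose of
the matrix of cofactors, so that both have the same sum of entries). -/
def cofSum {V : Type*} [Fintype V] [DecidableEq V] (A : Matrix V V ℤ) : ℤ :=
  ∑ i, ∑ j, A.adjugate i j

/-- The lengths (numbers of edges) of the three paths that make up `θ(l, p, q)`. -/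
def thetaLen (l p q : ℕ) : Fin 3 → ℕ := ![l, p, q]

/-- The vertices of `θ(l, p, q)`: the two common endpoints of the three paths, and the
`thetaLen l p q i - 1` inner vertices of the `i`-th path. -/
abbrev ThetaVertex (l p q : ℕ) : Type :=
  Fin 2 ⊕ (Σ i : Fin 3, Fin (thetaLen l p q i - 1))

/-- The vertex of `θ(l, p, q)` at position `k` of the `i`-th path. The positions `0` of the three
paths are identified with one another, and so are their last positions. -/
def thetaPathVertex (l p q : ℕ) (i : Fin 3) (k : Fin (thetaLen l p q i + 1)) :
    ThetaVertex l p q :=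
  if h0 : (k : ℕ) = 0 then Sum.inl 0
  else if hl : (k : ℕ) = thetaLen l p q i then Sum.inl 1
  else Sum.inr ⟨i, ⟨(k : ℕ) - 1, by omega⟩⟩

/-- The graph `θ(l, p, q)`, meant for `1 ≤ l` and `2 ≤ p, q`: its edges join consecutive positions
of each of the three paths, of lengths `l`, `p` and `q`. -/
def thetaGraph (l p q : ℕ) : SimpleGraph (ThetaVertex l p q) :=
  SimpleGraph.fromRel fun u v => ∃ (i : Fin 3) (k : Fin (thetaLen l p q i)),
    u = thetaPathVertex l p q i k.castSucc ∧ v = thetaPathVertex l p q i k.succ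

/-! ### Cofactor sums, and adjugates of cyclic permutation matrices. -/

section LinearAlgebra

open Matrix

variable {V W : Type*} [Fintype V] [DecidableEq V] [Fintype W] [DecidableEq W]

/-! Everything rests on cof A = 1ᵀ adj(A) 1.

Vanishing. cof A = 0 as soon as A kills a nonzero vector of coordinate sum zero. On two paths whose
lengths have the same parity, take the central segments of g edges, with g ∈ {1, 2} of that parity.
If no path is shorter than g, the difference of the distances from a vertex to the two ends is the
same for both segments (`thetaGraph_dist_balanced`), so the alternating sum of the four ends is in
the kernel. It is zero only if both paths have exactly g edges. Two of three lengths always agree in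
parity, and a usable pair is missing only in the listed families
(`cofSum_thetaGraph_eq_zero_of_sorted`).

θ(1, p, q) with p, q even. Differencing the distance matrix A twice along the Hamiltonian cycle
gives B A Bᵀ = -M Mᵀ, where B = 1 - rotation and M = 1 - π, with π cyclically permuting the edges,
each followed by an opposite one. All cofactors of B and M are 1, so adjugates give cof A =
(-1)^(n-1) n with n = p + q (`cofSum_of_cyclic_second_difference`).

θ(2, 2, q) with q > 1 odd. This is an odd cycle with one vertex doubled. An identity between a
vertex and its two antipodes inverts the cycle part up to row constants, and `det_mul_cofSum`
reduces the rest to a small linear system.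

θ(2, 2, 2) is a 5 × 5 computation. -/

theorem one_vecMul_adjugate_apply (A : Matrix V V ℤ) (j : V) :
    ((1 : V → ℤ) ᵥ* A.adjugate) j = (A.updateRow j 1).det := by
  have h : ((1 : V → ℤ) ᵥ* A.adjugate) j = cramer Aᵀ (1 : V → ℤ) j := by
    rw [cramer_eq_adjugate_mulVec, ← adjugate_transpose, mulVec_transpose]
  rw [h, cramer_apply, ← det_transpose, updateCol_transpose, transpose_transpose]

theorem cofSum_eq_dotProduct (A : Matrix V V ℤ) :
    cofSum A = ((1 : V → ℤ) ᵥ* A.adjugate) ⬝ᵥ 1 := by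
  simp only [cofSum, dotProduct, vecMul, Pi.one_apply, one_mul, mul_one]
  exact Finset.sum_comm

/-- The column sums of the adjugate do not change when each row is shifted by a constant. -/
theorem one_vecMul_adjugate_add_const (A B : Matrix V V ℤ) (u : V → ℤ)
    (h : ∀ i j, B i j = A i j + u i) :
    (1 : V → ℤ) ᵥ* B.adjugate = (1 : V → ℤ) ᵥ* A.adjugate := by
  funext j
  rw [one_vecMul_adjugate_apply, one_vecMul_adjugate_apply]
  -- Row `j` is now the all-ones row, so the shift of row `i` is `u i` times row `j`; row `j` itself
  -- gets coefficient 0.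
  refine det_eq_of_forall_row_eq_smul_add_const (Function.update u j 0) j (by simp) fun i l => ?_
  by_cases hi : i = j
  · subst hi; simp
  · simp [updateRow_ne hi, Function.update_of_ne hi, h]

theorem one_vecMul_adjugate_dotProduct_mulVec (A : Matrix V V ℤ) (y : V → ℤ) :
    ((1 : V → ℤ) ᵥ* A.adjugate) ⬝ᵥ (A *ᵥ y) = A.det * ∑ i, y i := by
  rw [← dotProduct_mulVec, mulVec_mulVec, adjugate_mul, smul_mulVec, one_mulVec]
  simp [dotProduct, Finset.mul_sum]

/-- Replacing a row of `A` by ones keeps `x` in the kernel because `x` sums to zero; hence every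
column sum of the adjugate vanishes. -/
theorem cofSum_eq_zero_of_mulVec_eq_zero (A : Matrix V V ℤ) (x : V → ℤ) (hx : x ≠ 0)
    (hs : ∑ i, x i = 0) (hA : A *ᵥ x = 0) : cofSum A = 0 := by
  rw [cofSum_eq_dotProduct]
  have : (1 : V → ℤ) ᵥ* A.adjugate = 0 := by
    funext j
    rw [one_vecMul_adjugate_apply]
    refine exists_mulVec_eq_zero_iff.mp ⟨x, hx, ?_⟩
    funext i
    by_cases hi : i = j
    · subst hi; simpa [mulVec, dotProduct] using hs
    · have := congrFun hA i
      simpa [mulVec, updateRow_ne hi] using this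
  simp [this]

theorem cofSum_submatrix_equiv (A : Matrix V V ℤ) (e : W ≃ V) :
    cofSum (A.submatrix e e) = cofSum A := by
  rw [cofSum, adjugate_submatrix_equiv_self, cofSum]
  simp only [submatrix_apply]
  rw [← e.sum_comp (fun i => ∑ j, A.adjugate i j)]
  exact Finset.sum_congr rfl fun i _ => e.sum_comp (fun j => A.adjugate (e i) j)

theorem permMatrix_apply {X : Type*} [DecidableEq X] (π : Equiv.Perm X) (i j : X) :
    π.permMatrix ℤ i j = if π i = j then 1 else 0 := by
  simp [PEquiv.toMatrix_apply, Equiv.toPEquiv_apply, eq_comm]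

theorem one_sub_permMatrix_mulVec (π : Equiv.Perm V) (v : V → ℤ) (i : V) :
    ((1 - π.permMatrix ℤ) *ᵥ v) i = v i - v (π i) := by
  rw [sub_mulVec, one_mulVec, permMatrix_mulVec]; rfl

theorem vecMul_one_sub_permMatrix (π : Equiv.Perm V) (v : V → ℤ) (i : V) :
    (v ᵥ* (1 - π.permMatrix ℤ)) (π i) = v (π i) - v i := by
  rw [vecMul_sub, vecMul_one, vecMul_permMatrix]; simp

theorem fin_const_of_add_one {n : ℕ} (f : Fin (n + 1) → ℤ) (h : ∀ i, f (i + 1) = f i)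
    (i : Fin (n + 1)) : f i = f (Fin.last n) := by
  have key : ∀ m (hm : m < n + 1), f ⟨m, hm⟩ = f 0 := by
    intro m
    induction m with
    | zero => intro _; rfl
    | succ m ih =>
      intro hm
      rw [← ih (by omega), ← h ⟨m, by omega⟩]
      congr 1
      ext
      rw [Fin.val_add_one_of_lt (by simp [Fin.lt_def]; omega)]
  rw [key i.1 i.2]
  exact (key n (by omega)).symm

/-- The matrix is singular, so its products with the adjugate vanish and the adjugate is rotation
invariant in both indices, hence constant. The constant is a corner minor, which is unitriangular.
-/
theorem adjugate_one_sub_finRotate (n : ℕ) :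
    (1 - (finRotate (n + 1)).permMatrix ℤ).adjugate = of fun _ _ => 1 := by
  set B := 1 - (finRotate (n + 1)).permMatrix ℤ with hB
  have hdet : B.det = 0 := by
    refine exists_mulVec_eq_zero_iff.mp ⟨1, one_ne_zero, ?_⟩
    funext i
    rw [hB, one_sub_permMatrix_mulVec]; simp
  have hcol : ∀ i j, B.adjugate (i + 1) j = B.adjugate i j := by
    intro i j
    have h := congrFun (congrFun (mul_adjugate B) i) j
    rw [hdet, zero_smul] at h
    have h2 := one_sub_permMatrix_mulVec (finRotate (n + 1)) (fun l => B.adjugate l j) i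
    rw [finRotate_apply] at h2
    have h3 : ((B *ᵥ fun l => B.adjugate l j) i) = (B * B.adjugate) i j := rfl
    rw [← hB, h3, h] at h2
    simp at h2; linarith
  have hrow : ∀ i j, B.adjugate i (j + 1) = B.adjugate i j := by
    intro i j
    have h := congrFun (congrFun (adjugate_mul B) i) (j + 1)
    rw [hdet, zero_smul] at h
    have h2 := vecMul_one_sub_permMatrix (finRotate (n + 1)) (fun l => B.adjugate i l) j
    rw [finRotate_apply] at h2
    have h3 : (((fun l => B.adjugate i l) ᵥ* B) (j + 1)) = (B.adjugate * B) i (j + 1) := rfl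
    rw [← hB, h3, h] at h2
    simp at h2; linarith
  have hlast : B.adjugate (Fin.last n) (Fin.last n) = 1 := by
    rw [adjugate_fin_succ_eq_det_submatrix, Fin.succAbove_last, ← two_mul, pow_mul]
    have hent : ∀ i j : Fin n, (B.submatrix Fin.castSucc Fin.castSucc) i j =
        (if i = j then 1 else 0) - if (i : ℕ) + 1 = j then 1 else 0 := by
      intro i j
      rw [submatrix_apply, hB, Matrix.sub_apply, permMatrix_apply, one_apply, finRotate_apply]
      simp [Fin.ext_iff]
    rw [det_of_isUpperTriangular]
    · rw [Finset.prod_eq_one]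
      · simp
      · intro i _; rw [hent]; simp
    · intro i j hij
      have hij' : (j : ℕ) < i := hij
      rw [hent, if_neg (by intro h; subst h; omega), if_neg (by omega)]; simp
  ext i j
  rw [fin_const_of_add_one (fun i => B.adjugate i j) (fun i => hcol i j) i,
    fin_const_of_add_one (fun j => B.adjugate _ j) (fun j => hrow _ j) j, hlast, of_apply]

/-- If `π` is a cyclic permutation of all of `V`, all cofactors of `1 - π` are `1`. -/
theorem adjugate_one_sub_permMatrix {n : ℕ} [NeZero n] (π : Equiv.Perm V) (τ : Fin n ≃ V)
    (h : ∀ s, π (τ s) = τ (s + 1)) :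
    (1 - π.permMatrix ℤ).adjugate = of fun _ _ => 1 := by
  obtain ⟨m, rfl⟩ := Nat.exists_eq_succ_of_ne_zero (NeZero.ne n)
  have hs : (1 - π.permMatrix ℤ).submatrix τ τ = 1 - (finRotate (m + 1)).permMatrix ℤ := by
    ext s t
    rw [submatrix_apply, Matrix.sub_apply, Matrix.sub_apply, permMatrix_apply, permMatrix_apply, h,
      finRotate_apply, one_apply, one_apply]
    simp
  have h2 := adjugate_submatrix_equiv_self τ (1 - π.permMatrix ℤ)
  rw [hs, adjugate_one_sub_finRotate] at h2
  ext i j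
  have := congrFun (congrFun h2 (τ.symm i)) (τ.symm j)
  simpa using this.symm

end LinearAlgebra

/-! ### Distances in theta graphs. -/

section ThetaMetric

theorem SimpleGraph.Walk.le_add_length_of_lipschitz {V : Type*} {G : SimpleGraph V} (F : V → ℕ)
    (hF : ∀ v w, G.Adj v w → F w ≤ F v + 1) {u v : V} (c : G.Walk u v) :
    F v ≤ F u + c.length := by
  induction c with
  | nil => simp
  | cons h c ih =>
    have := hF _ _ h
    rw [SimpleGraph.Walk.length_cons]; omega

theorem SimpleGraph.Iso.dist_eq {V W : Type*} {G : SimpleGraph V} {H : SimpleGraph W}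
    (f : G ≃g H) (hH : H.Connected) (u v : V) : G.dist u v = H.dist (f u) (f v) := by
  have hG : G.Connected := f.connected_iff.mpr hH
  apply le_antisymm
  · obtain ⟨c, hc⟩ := hH.exists_walk_length_eq_dist (f u) (f v)
    rw [← hc]
    have h := SimpleGraph.dist_le (c.map f.symm.toHom)
    simpa using h
  · obtain ⟨c, hc⟩ := hG.exists_walk_length_eq_dist u v
    rw [← hc]
    have h := SimpleGraph.dist_le (c.map f.toHom)
    simpa using h

theorem cofSum_distMatrix_of_iso {V W : Type*} [Fintype V] [DecidableEq V] [Fintype W]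
    [DecidableEq W] {G : SimpleGraph V} {H : SimpleGraph W} (f : G ≃g H) (hH : H.Connected) :
    cofSum (distMatrix G) = cofSum (distMatrix H) := by
  rw [← cofSum_submatrix_equiv (distMatrix H) f.toEquiv]
  congr 1
  ext u v
  simp [distMatrix, f.dist_eq hH]

variable (l p q : ℕ)

/-- The vertex of `θ(l, p, q)` at position `k` of the `i`-th path, for a natural number `k`. -/
def thetaAt (i : Fin 3) (k : ℕ) : ThetaVertex l p q :=
  if h0 : k = 0 then Sum.inl 0
  else if h : k < thetaLen l p q i then Sum.inr ⟨i, ⟨k - 1, by omega⟩⟩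
  else Sum.inl 1

variable {l p q}

theorem thetaPathVertex_eq_thetaAt (i : Fin 3) (k : Fin (thetaLen l p q i + 1)) :
    thetaPathVertex l p q i k = thetaAt l p q i k := by
  have := k.2
  unfold thetaPathVertex thetaAt
  split_ifs <;> first | rfl | omega

@[simp] theorem thetaAt_zero (i : Fin 3) : thetaAt l p q i 0 = Sum.inl 0 := by simp [thetaAt]

theorem thetaAt_inner {i : Fin 3} {k : ℕ} (h0 : k ≠ 0) (h : k < thetaLen l p q i) :
    thetaAt l p q i k = Sum.inr ⟨i, ⟨k - 1, by omega⟩⟩ := by simp [thetaAt, h0, h]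

theorem thetaAt_len {i : Fin 3} (h : 1 ≤ thetaLen l p q i) :
    thetaAt l p q i (thetaLen l p q i) = Sum.inl 1 := by
  have : thetaLen l p q i ≠ 0 := by omega
  simp [thetaAt, this]

theorem exists_thetaAt (h : ∀ i, 1 ≤ thetaLen l p q i) (v : ThetaVertex l p q) :
    ∃ i k, k ≤ thetaLen l p q i ∧ v = thetaAt l p q i k := by
  rcases v with x | ⟨i, k⟩
  · fin_cases x
    · exact ⟨0, 0, by simp, by simp⟩
    · exact ⟨0, _, le_rfl, (thetaAt_len (h 0)).symm⟩
  · refine ⟨i, k + 1, by omega, ?_⟩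
    rw [thetaAt_inner (by omega) (by omega)]
    simp

theorem thetaAt_eq_iff (h : ∀ i, 1 ≤ thetaLen l p q i) {i j : Fin 3} {k m : ℕ}
    (hk : k ≤ thetaLen l p q i) (hm : m ≤ thetaLen l p q j) :
    thetaAt l p q i k = thetaAt l p q j m ↔
      (k = 0 ∧ m = 0) ∨ (k = thetaLen l p q i ∧ m = thetaLen l p q j) ∨ (i = j ∧ k = m) := by
  have hi := h i
  have hj := h j
  rcases Nat.eq_zero_or_pos k with rfl | hk0
  · rcases Nat.eq_zero_or_pos m with rfl | hm0
    · simp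
    · rcases hm.lt_or_eq with hm' | rfl
      · rw [thetaAt_inner (by omega) hm', thetaAt_zero]
        simp only [reduceCtorEq, false_iff]; omega
      · rw [thetaAt_len hj, thetaAt_zero]
        simp only [Sum.inl.injEq, zero_ne_one, false_iff]; omega
  · rcases hk.lt_or_eq with hk' | rfl
    · rw [thetaAt_inner (by omega) hk']
      rcases Nat.eq_zero_or_pos m with rfl | hm0
      · simp only [thetaAt_zero, reduceCtorEq, false_iff]; omega
      · rcases hm.lt_or_eq with hm' | rfl
        · rw [thetaAt_inner (by omega) hm']
          constructor
          · intro he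
            rw [Sum.inr.injEq, Sigma.mk.injEq] at he
            obtain ⟨rfl, he⟩ := he
            have := Fin.mk.inj (eq_of_heq he)
            exact Or.inr (Or.inr ⟨rfl, by omega⟩)
          · rintro (he | he | ⟨rfl, rfl⟩)
            · omega
            · omega
            · rfl
        · rw [thetaAt_len hj]
          simp only [reduceCtorEq, false_iff]
          rintro (he | he | ⟨rfl, rfl⟩) <;> omega
    · rw [thetaAt_len hi]
      rcases Nat.eq_zero_or_pos m with rfl | hm0
      · simp only [thetaAt_zero, Sum.inl.injEq, one_ne_zero, false_iff]; omega
      · rcases hm.lt_or_eq with hm' | rfl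
        · rw [thetaAt_inner (by omega) hm']
          simp only [reduceCtorEq, false_iff]
          rintro (he | he | ⟨rfl, he⟩) <;> omega
        · rw [thetaAt_len hj]; simp

theorem thetaGraph_adj_iff (u v : ThetaVertex l p q) :
    (thetaGraph l p q).Adj u v ↔ u ≠ v ∧ ∃ i k, k < thetaLen l p q i ∧
      ((u = thetaAt l p q i k ∧ v = thetaAt l p q i (k + 1)) ∨
        (v = thetaAt l p q i k ∧ u = thetaAt l p q i (k + 1))) := by
  simp only [thetaGraph, SimpleGraph.fromRel_adj, thetaPathVertex_eq_thetaAt, Fin.val_castSucc,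
    Fin.val_succ]
  refine and_congr_right fun _ => ⟨?_, ?_⟩
  · rintro (⟨i, k, h⟩ | ⟨i, k, h⟩)
    · exact ⟨i, k, k.2, Or.inl h⟩
    · exact ⟨i, k, k.2, Or.inr h⟩
  · rintro ⟨i, k, hk, h | h⟩
    · exact Or.inl ⟨i, ⟨k, hk⟩, h⟩
    · exact Or.inr ⟨i, ⟨k, hk⟩, h⟩

theorem thetaGraph_adj_succ (h : ∀ i, 1 ≤ thetaLen l p q i) {i : Fin 3} {k : ℕ}
    (hk : k < thetaLen l p q i) :
    (thetaGraph l p q).Adj (thetaAt l p q i k) (thetaAt l p q i (k + 1)) := by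
  rw [thetaGraph_adj_iff]
  refine ⟨?_, i, k, hk, Or.inl ⟨rfl, rfl⟩⟩
  rw [Ne, thetaAt_eq_iff h hk.le hk]
  omega

theorem thetaGraph_exists_walk (h : ∀ i, 1 ≤ thetaLen l p q i) (i : Fin 3) (k d : ℕ)
    (hk : k + d ≤ thetaLen l p q i) :
    ∃ c : (thetaGraph l p q).Walk (thetaAt l p q i k) (thetaAt l p q i (k + d)), c.length = d := by
  induction d with
  | zero => exact ⟨SimpleGraph.Walk.nil, rfl⟩
  | succ d ih =>
    obtain ⟨c, hc⟩ := ih (by omega)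
    exact ⟨c.concat (thetaGraph_adj_succ h (by omega)), by simp [hc]⟩

theorem thetaGraph_connected (h : ∀ i, 1 ≤ thetaLen l p q i) : (thetaGraph l p q).Connected := by
  rw [SimpleGraph.connected_iff_exists_forall_reachable]
  refine ⟨Sum.inl 0, fun v => ?_⟩
  obtain ⟨i, k, hk, rfl⟩ := exists_thetaAt h v
  obtain ⟨c, -⟩ := thetaGraph_exists_walk h i 0 k (by omega)
  rw [thetaAt_zero, zero_add] at c
  exact ⟨c⟩

theorem thetaGraph_dist_le_sub (h : ∀ i, 1 ≤ thetaLen l p q i) {i : Fin 3} {k m : ℕ}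
    (hkm : k ≤ m) (hm : m ≤ thetaLen l p q i) :
    (thetaGraph l p q).dist (thetaAt l p q i k) (thetaAt l p q i m) ≤ m - k := by
  obtain ⟨d, rfl⟩ := Nat.exists_eq_add_of_le hkm
  obtain ⟨c, hc⟩ := thetaGraph_exists_walk h i k d hm
  have := SimpleGraph.dist_le c
  omega

/-- The distance in a theta graph between position `k` of a path of length `a` and position `m` of
a path of length `b`, where `s` is the least length of a path, for two different paths. -/
def thetaDistNe (s a b k m : ℕ) : ℕ :=
  min (min (k + m) (a - k + (b - m))) (min (k + (b - m) + s) (a - k + m + s))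

/-- The distance in a theta graph between the positions `k` and `m` of a path of length `a`,
where `s` is the least length of a path. -/
def thetaDistEq (s a k m : ℕ) : ℕ :=
  min (min (k - m + (m - k)) (k + (a - m) + s)) (a - k + m + s)

theorem thetaGraph_dist_le_ne (h : ∀ i, 1 ≤ thetaLen l p q i) {i j : Fin 3} (i₀ : Fin 3) {k m : ℕ}
    (hk : k ≤ thetaLen l p q i) (hm : m ≤ thetaLen l p q j) :
    (thetaGraph l p q).dist (thetaAt l p q i k) (thetaAt l p q j m) ≤
      thetaDistNe (thetaLen l p q i₀) (thetaLen l p q i) (thetaLen l p q j) k m := by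
  have hc := thetaGraph_connected h
  have a1 := thetaGraph_dist_le_sub h (Nat.zero_le k) hk
  have a2 := thetaGraph_dist_le_sub h (Nat.zero_le m) hm
  have a3 := thetaGraph_dist_le_sub h hk le_rfl
  have a4 := thetaGraph_dist_le_sub h hm le_rfl
  have a5 := thetaGraph_dist_le_sub h (Nat.zero_le _) (le_refl (thetaLen l p q i₀))
  rw [thetaAt_zero] at a1 a2 a5
  rw [thetaAt_len (h _)] at a3 a4 a5
  generalize thetaAt l p q i k = u at *
  generalize thetaAt l p q j m = v at *
  rw [SimpleGraph.dist_comm] at a1 a4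
  have t1 := hc.dist_triangle (u := u) (v := Sum.inl 0) (w := v)
  have t2 := hc.dist_triangle (u := u) (v := Sum.inl 1) (w := v)
  have t3 := hc.dist_triangle (u := Sum.inl 0) (v := Sum.inl 1) (w := v)
  have t4 := hc.dist_triangle (u := Sum.inl 1) (v := Sum.inl 0) (w := v)
  have t5 := SimpleGraph.dist_comm (G := thetaGraph l p q) (u := Sum.inl 1) (v := Sum.inl 0)
  unfold thetaDistNe
  simp only [le_min_iff]
  omega

theorem thetaGraph_dist_le_eq (h : ∀ i, 1 ≤ thetaLen l p q i) {i : Fin 3} (i₀ : Fin 3) {k m : ℕ}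
    (hk : k ≤ thetaLen l p q i) (hm : m ≤ thetaLen l p q i) :
    (thetaGraph l p q).dist (thetaAt l p q i k) (thetaAt l p q i m) ≤
      thetaDistEq (thetaLen l p q i₀) (thetaLen l p q i) k m := by
  have a1 := thetaGraph_dist_le_ne h i₀ hk hm
  have a2 : (thetaGraph l p q).dist (thetaAt l p q i k) (thetaAt l p q i m) ≤ k - m + (m - k) := by
    rcases le_total k m with hkm | hkm
    · have := thetaGraph_dist_le_sub h hkm hm; omega
    · have := thetaGraph_dist_le_sub h hkm hk
      rw [SimpleGraph.dist_comm]; omega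
  unfold thetaDistEq
  unfold thetaDistNe at a1
  simp only [le_min_iff] at a1 ⊢
  omega

/-- The distances from position `k` of the `i`-th path, where `s` is the least path length. -/
def thetaDistFrom (s : ℕ) (i : Fin 3) (k : ℕ) : ThetaVertex l p q → ℕ
  | Sum.inl x => if x = 0 then min k (thetaLen l p q i - k + s)
      else min (thetaLen l p q i - k) (k + s)
  | Sum.inr ⟨j, m⟩ => if i = j then thetaDistEq s (thetaLen l p q i) k (m + 1)
      else thetaDistNe s (thetaLen l p q i) (thetaLen l p q j) k (m + 1)

theorem thetaDistFrom_thetaAt {s : ℕ} (h : ∀ i, 1 ≤ thetaLen l p q i)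
    (hs : ∀ i, s ≤ thetaLen l p q i) {i j : Fin 3} {k m : ℕ}
    (hk : k ≤ thetaLen l p q i) (hm : m ≤ thetaLen l p q j) :
    thetaDistFrom s i k (thetaAt l p q j m) =
      if i = j then thetaDistEq s (thetaLen l p q i) k m
      else thetaDistNe s (thetaLen l p q i) (thetaLen l p q j) k m := by
  have hi := hs i
  have hj := hs j
  have hj1 := h j
  rcases Nat.eq_zero_or_pos m with rfl | hm0
  · rw [thetaAt_zero]
    simp only [thetaDistFrom, if_true, thetaDistEq, thetaDistNe]
    split_ifs with hij
    · omega
    · omega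
  · rcases hm.lt_or_eq with hm' | rfl
    · rw [thetaAt_inner (by omega) hm']
      simp only [thetaDistFrom]
      rw [Nat.sub_add_cancel hm0]
    · rw [thetaAt_len hj1]
      simp only [thetaDistFrom, if_neg one_ne_zero, thetaDistEq, thetaDistNe]
      split_ifs with hij
      · subst hij; omega
      · omega

/-- Explicit walks through the branch vertices give the upper bound. For the lower bound, the
candidate formula vanishes at the source and changes by at most one along each edge. -/
theorem thetaGraph_dist {i₀ : Fin 3} (h₀ : 1 ≤ thetaLen l p q i₀)
    (hs : ∀ i, thetaLen l p q i₀ ≤ thetaLen l p q i) {i j : Fin 3} {k m : ℕ}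
    (hk : k ≤ thetaLen l p q i) (hm : m ≤ thetaLen l p q j) :
    (thetaGraph l p q).dist (thetaAt l p q i k) (thetaAt l p q j m) =
      if i = j then thetaDistEq (thetaLen l p q i₀) (thetaLen l p q i) k m
      else thetaDistNe (thetaLen l p q i₀) (thetaLen l p q i) (thetaLen l p q j) k m := by
  have h : ∀ i, 1 ≤ thetaLen l p q i := fun i => h₀.trans (hs i)
  apply le_antisymm
  · split_ifs with hij
    · subst hij
      exact thetaGraph_dist_le_eq h i₀ hk hm
    · exact thetaGraph_dist_le_ne h i₀ hk hm
  · rw [← thetaDistFrom_thetaAt h hs hk hm]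
    obtain ⟨c, hc⟩ := (thetaGraph_connected h).exists_walk_length_eq_dist
      (thetaAt l p q i k) (thetaAt l p q j m)
    rw [← hc]
    have key := c.le_add_length_of_lipschitz (thetaDistFrom (thetaLen l p q i₀) i k) ?_
    · rw [thetaDistFrom_thetaAt h hs hk hk, if_pos rfl] at key
      have : thetaDistEq (thetaLen l p q i₀) (thetaLen l p q i) k k = 0 := by
        unfold thetaDistEq; omega
      omega
    · have step : ∀ (j : Fin 3) (m : ℕ), m < thetaLen l p q j →
          thetaDistFrom (thetaLen l p q i₀) i k (thetaAt l p q j m) ≤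
            thetaDistFrom (thetaLen l p q i₀) i k (thetaAt l p q j (m + 1)) + 1 ∧
          thetaDistFrom (thetaLen l p q i₀) i k (thetaAt l p q j (m + 1)) ≤
            thetaDistFrom (thetaLen l p q i₀) i k (thetaAt l p q j m) + 1 := by
        intro j m hm
        rw [thetaDistFrom_thetaAt h hs hk hm.le, thetaDistFrom_thetaAt h hs hk hm]
        unfold thetaDistEq thetaDistNe
        split_ifs with hij
        · subst hij; omega
        · omega
      intro v w hvw
      rw [thetaGraph_adj_iff] at hvw
      obtain ⟨-, j, m, hm, ⟨rfl, rfl⟩ | ⟨rfl, rfl⟩⟩ := hvw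
      · exact (step j m hm).2
      · exact (step j m hm).1

/-- Permuting the three path lengths does not change the theta graph. -/
theorem thetaGraph_iso_of_perm {l' p' q' : ℕ} (σ : Equiv.Perm (Fin 3))
    (hσ : ∀ i, thetaLen l' p' q' i = thetaLen l p q (σ i)) :
    Nonempty (thetaGraph l' p' q' ≃g thetaGraph l p q) := by
  let e : ThetaVertex l' p' q' ≃ ThetaVertex l p q :=
    Equiv.sumCongr (Equiv.refl _)
      (Equiv.sigmaCongr σ fun i => finCongr (by rw [hσ]))
  have he : ∀ i k, e (thetaAt l' p' q' i k) = thetaAt l p q (σ i) k := by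
    intro i k
    simp only [thetaAt, hσ]
    split_ifs with h0 h1
    · rfl
    · rfl
    · rfl
  refine ⟨⟨e, ?_⟩⟩
  intro u v
  rw [thetaGraph_adj_iff, thetaGraph_adj_iff, e.injective.ne_iff]
  refine and_congr_right fun _ => ⟨?_, ?_⟩
  · rintro ⟨i, k, hk, hh⟩
    obtain ⟨i, rfl⟩ := σ.surjective i
    refine ⟨i, k, by rwa [hσ], ?_⟩
    simpa only [← he, e.injective.eq_iff] using hh
  · rintro ⟨i, k, hk, hh⟩
    refine ⟨σ i, k, by rwa [← hσ], ?_⟩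
    simpa only [← he, e.injective.eq_iff] using hh

end ThetaMetric

/-! ### Kernel vectors from two paths of equal parity. -/

section Vanishing

open Matrix

variable {l p q : ℕ}

/-- Positions `a` and `a + g` bound the central segment of a path of length `2 * a + g`. As `g ≤ s`,
leaving the path never shortens the way to them. -/
theorem thetaDistEq_lower {s g a t : ℕ} (hgs : g ≤ s) (ht : t ≤ 2 * a + g) :
    thetaDistEq s (2 * a + g) t a = t - a + (a - t) := by
  unfold thetaDistEq; omega

theorem thetaDistEq_upper {s g a t : ℕ} (hgs : g ≤ s) (ht : t ≤ 2 * a + g) :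
    thetaDistEq s (2 * a + g) t (a + g) = t - (a + g) + (a + g - t) := by
  unfold thetaDistEq; omega

theorem thetaDistNe_lower {s g c a t : ℕ} (hgs : g ≤ s) :
    thetaDistNe s c (2 * a + g) t a = a + min t (c - t + g) := by
  unfold thetaDistNe; omega

theorem thetaDistNe_upper {s g c a t : ℕ} (hgs : g ≤ s) :
    thetaDistNe s c (2 * a + g) t (a + g) = a + min (t + g) (c - t) := by
  unfold thetaDistNe; omega

/-- Seen from another path, the distances to the two ends exceed `a` by amounts that do not involve
`a`, so their difference forgets which path carries the segment. From inside one of the two paths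
the differences agree by direct comparison. -/
theorem thetaGraph_dist_balanced {i₀ i j : Fin 3} (h₀ : 1 ≤ thetaLen l p q i₀)
    (hs : ∀ i, thetaLen l p q i₀ ≤ thetaLen l p q i) (hij : i ≠ j) {g a b : ℕ}
    (hgs : g ≤ thetaLen l p q i₀)
    (ha : 2 * a + g = thetaLen l p q i) (hb : 2 * b + g = thetaLen l p q j)
    (u : ThetaVertex l p q) :
    (thetaGraph l p q).dist u (thetaAt l p q i a) +
      (thetaGraph l p q).dist u (thetaAt l p q j (b + g)) =
    (thetaGraph l p q).dist u (thetaAt l p q i (a + g)) +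
      (thetaGraph l p q).dist u (thetaAt l p q j b) := by
  obtain ⟨m, t, ht, rfl⟩ := exists_thetaAt (fun i => h₀.trans (hs i)) u
  rw [thetaGraph_dist h₀ hs ht (by omega), thetaGraph_dist h₀ hs ht (by omega),
    thetaGraph_dist h₀ hs ht (by omega), thetaGraph_dist h₀ hs ht (by omega)]
  rw [← ha, ← hb]
  by_cases hmi : m = i
  · subst hmi
    rw [← ha] at ht ⊢
    simp only [hij, if_true, if_false, thetaDistEq_lower hgs ht, thetaDistEq_upper hgs ht,
      thetaDistNe_lower hgs, thetaDistNe_upper hgs]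
    omega
  · by_cases hmj : m = j
    · subst hmj
      rw [← hb] at ht ⊢
      simp only [hmi, if_true, if_false, thetaDistEq_lower hgs ht, thetaDistEq_upper hgs ht,
        thetaDistNe_lower hgs, thetaDistNe_upper hgs]
      omega
    · simp only [hmi, hmj, if_false, thetaDistNe_lower hgs, thetaDistNe_upper hgs]
      omega

/-- If two of the three paths have lengths of the same parity as some `g ∈ {1, 2}` which is at most
the least length, and one of them is longer than `g`, then the cofactor sum vanishes. -/
theorem cofSum_thetaGraph_eq_zero {i₀ i j : Fin 3} (h₀ : 1 ≤ thetaLen l p q i₀)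
    (hs : ∀ i, thetaLen l p q i₀ ≤ thetaLen l p q i) (hij : i ≠ j) {g a b : ℕ}
    (hg : g = 1 ∨ g = 2) (hgs : g ≤ thetaLen l p q i₀)
    (ha : 2 * a + g = thetaLen l p q i) (hb : 2 * b + g = thetaLen l p q j) (ha0 : 0 < a) :
    cofSum (distMatrix (thetaGraph l p q)) = 0 := by
  have h1 : ∀ i, 1 ≤ thetaLen l p q i := fun i => h₀.trans (hs i)
  have n1 : thetaAt l p q i a ≠ thetaAt l p q i (a + g) := by
    rw [Ne, thetaAt_eq_iff h1 (by omega) (by omega)]; omega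
  have n2 : thetaAt l p q i a ≠ thetaAt l p q j b := by
    rw [Ne, thetaAt_eq_iff h1 (by omega) (by omega)]
    rintro (h | h | h)
    · omega
    · omega
    · exact hij h.1
  have n3 : thetaAt l p q i a ≠ thetaAt l p q j (b + g) := by
    rw [Ne, thetaAt_eq_iff h1 (by omega) (by omega)]
    rintro (h | h | h)
    · omega
    · omega
    · exact hij h.1
  -- The alternating sum of the segment ends; `0 < a` separates the first end from the other three,
  -- so it is nonzero.
  refine cofSum_eq_zero_of_mulVec_eq_zero _
    (Pi.single (thetaAt l p q i a) 1 - Pi.single (thetaAt l p q i (a + g)) 1 -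
      Pi.single (thetaAt l p q j b) 1 + Pi.single (thetaAt l p q j (b + g)) 1) ?_ ?_ ?_
  · intro h
    have := congrFun h (thetaAt l p q i a)
    simp [n1, n2, n3] at this
  · simp [Finset.sum_add_distrib, Finset.sum_sub_distrib]
  · funext u
    have := thetaGraph_dist_balanced h₀ hs hij hgs ha hb u
    simp only [mulVec_add, mulVec_sub, mulVec_single_one, Pi.add_apply, Pi.sub_apply,
      Pi.zero_apply, col_apply, distMatrix, of_apply]
    zify at this
    linarith

theorem cofSum_thetaGraph_eq_zero_of_parity {i₀ i j : Fin 3} (h₀ : 1 ≤ thetaLen l p q i₀)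
    (hs : ∀ i, thetaLen l p q i₀ ≤ thetaLen l p q i) (hij : i ≠ j)
    (hpar : thetaLen l p q i % 2 = thetaLen l p q j % 2)
    (heven : thetaLen l p q i % 2 = 0 → 2 ≤ thetaLen l p q i₀)
    (hlong : 3 ≤ thetaLen l p q i ∨ 3 ≤ thetaLen l p q j) :
    cofSum (distMatrix (thetaGraph l p q)) = 0 := by
  have hi := hs i
  have hj := hs j
  obtain ⟨g, a, b, hg, hgs, ha, hb⟩ : ∃ g a b, (g = 1 ∨ g = 2) ∧ g ≤ thetaLen l p q i₀ ∧
      2 * a + g = thetaLen l p q i ∧ 2 * b + g = thetaLen l p q j := by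
    rcases Nat.mod_two_eq_zero_or_one (thetaLen l p q i) with h | h
    · have := heven h
      exact ⟨2, thetaLen l p q i / 2 - 1, thetaLen l p q j / 2 - 1, by omega, by omega, by omega,
        by omega⟩
    · exact ⟨1, thetaLen l p q i / 2, thetaLen l p q j / 2, by omega, by omega, by omega,
        by omega⟩
  rcases Nat.eq_zero_or_pos a with ha0 | ha0
  · exact cofSum_thetaGraph_eq_zero h₀ hs hij.symm hg hgs hb ha (by omega)
  · exact cofSum_thetaGraph_eq_zero h₀ hs hij hg hgs ha hb ha0

end Vanishing

/-! ### Second differences of distances along a Hamiltonian cycle. -/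

section BookGraph

open Matrix

/-- If the second differences of `A` along a Hamiltonian cycle of the index set form the negative
Laplacian of another Hamiltonian cycle, given by the permutation `π`, then `cof A = ± n`. -/
theorem cofSum_of_cyclic_second_difference {n : ℕ} [NeZero n] (A : Matrix (Fin n) (Fin n) ℤ)
    (π : Equiv.Perm (Fin n)) (τ : Fin n ≃ Fin n) (hπ : ∀ s, π (τ s) = τ (s + 1))
    (hA : ∀ i j, A i j - A (i + 1) j - A i (j + 1) + A (i + 1) (j + 1) =
      -2 * (if i = j then 1 else 0) + (if π i = j then 1 else 0) + if π j = i then 1 else 0) :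
    cofSum A = (-1) ^ (n - 1) * n := by
  set B := 1 - (finRotate n).permMatrix ℤ with hB
  set M := 1 - π.permMatrix ℤ with hM
  have hBadj : B.adjugate = of fun _ _ => 1 :=
    adjugate_one_sub_permMatrix (finRotate n) (Equiv.refl _) fun s => by simp
  have hMadj : M.adjugate = of fun _ _ => 1 := adjugate_one_sub_permMatrix π τ hπ
  have hmul : ∀ (ρ : Equiv.Perm (Fin n)) (C : Matrix (Fin n) (Fin n) ℤ) (i j : Fin n),
      ((1 - ρ.permMatrix ℤ) * C) i j = C i j - C (ρ i) j := fun ρ C i j =>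
    one_sub_permMatrix_mulVec ρ (fun l => C l j) i
  have hmulT : ∀ (ρ : Equiv.Perm (Fin n)) (C : Matrix (Fin n) (Fin n) ℤ) (i j : Fin n),
      (C * (1 - ρ.permMatrix ℤ)ᵀ : Matrix (Fin n) (Fin n) ℤ) i j = C i j - C i (ρ j) := fun ρ C i j => by
    have := hmul ρ Cᵀ j i
    rw [← transpose_transpose ((1 - ρ.permMatrix ℤ) * Cᵀ), transpose_mul] at this
    simpa using this
  have key : B * A * Bᵀ = -(M * Mᵀ) := by
    ext i j
    rw [hmulT, hmul, hmul, Matrix.neg_apply, hmulT, hM, Matrix.sub_apply, Matrix.sub_apply,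
      permMatrix_apply, permMatrix_apply, one_apply, one_apply, finRotate_apply, finRotate_apply]
    have := hA i j
    simp only [π.injective.eq_iff, eq_comm (a := i) (b := π j)]
    linarith
  have h := congrArg adjugate key
  -- With `adj B` all ones, every entry of this adjugate is the cofactor sum; one entry suffices.
  have h1 : (B * A * Bᵀ).adjugate 0 0 = cofSum A := by
    rw [adjugate_mul_distrib, adjugate_mul_distrib, ← adjugate_transpose, hBadj]
    simp only [mul_apply, transpose_apply, of_apply, one_mul, mul_one, cofSum]
  have h2 : (-(M * Mᵀ)).adjugate 0 0 = (-1) ^ (n - 1) * n := by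
    rw [← neg_one_smul ℤ (M * Mᵀ), adjugate_smul, adjugate_mul_distrib, ← adjugate_transpose,
      hMadj]
    simp [mul_apply]
  rw [← h1, h, h2]

/-- The path and the chord form a cycle of length `2 * k + 1`. The change of distance across edge
`i`, as a function of `j`, jumps only at edge `i` and at its two opposite edges. -/
theorem thetaDistEq_one_second_difference {k i j : ℕ} (hi : i < 2 * k) (hj : j < 2 * k) :
    (thetaDistEq 1 (2 * k) i j : ℤ) - thetaDistEq 1 (2 * k) (i + 1) j
      - thetaDistEq 1 (2 * k) i (j + 1) + thetaDistEq 1 (2 * k) (i + 1) (j + 1) =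
    -2 * (if i = j then 1 else 0) + (if j = i + k ∨ j = i + k + 1 then 1 else 0) +
      if i = j + k ∨ i = j + k + 1 then 1 else 0 := by
  have h : ∀ i j, i < 2 * k → j ≤ 2 * k →
      (thetaDistEq 1 (2 * k) i j : ℤ) - thetaDistEq 1 (2 * k) (i + 1) j =
      if i < k then (if j ≤ i then -1 else if j ≤ i + k then 1 else if j = i + k + 1 then 0 else -1)
      else (if j + k < i then 1 else if j + k = i then 0 else if j ≤ i then -1 else 1) := by
    intro i j hi hj
    have h1 : ∀ i, i ≤ 2 * k → (thetaDistEq 1 (2 * k) i j : ℤ) =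
        if i + k < j then (i : ℤ) + (2 * k - j) + 1 else if i ≤ j then (j : ℤ) - i else
        if j + k < i then (j : ℤ) + (2 * k - i) + 1 else (i : ℤ) - j := by
      intro i hi
      unfold thetaDistEq
      split_ifs <;> omega
    rw [h1 i hi.le, h1 (i + 1) hi]
    split_ifs <;> omega
  have h1 := h i j hi hj.le
  have h2 := h i (j + 1) hi hj
  have e : ∀ a b c d : ℤ, a - b - c + d = a - b - (c - d) := by intros; ring
  rw [e, h1, h2]
  clear h h1 h2 e
  by_cases hik : i < k
  · simp only [hik, if_true]
    split_ifs <;> omega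
  · simp only [hik, if_false]
    split_ifs <;> omega

/-- Only the middle edges, opposite to the chord in their own cycles, interact. The minus sign
becomes a plus once the second path is traversed backwards. -/
theorem thetaDistNe_one_second_difference {k m i j : ℕ} (hi : i < 2 * k) (hj : j < 2 * m) :
    (thetaDistNe 1 (2 * k) (2 * m) i j : ℤ) - thetaDistNe 1 (2 * k) (2 * m) (i + 1) j
      - thetaDistNe 1 (2 * k) (2 * m) i (j + 1) + thetaDistNe 1 (2 * k) (2 * m) (i + 1) (j + 1) =
    - if (i + 1 = k ∧ j = m) ∨ (i = k ∧ j + 1 = m) then 1 else 0 := by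
  have h : ∀ j, j ≤ 2 * m →
      (thetaDistNe 1 (2 * k) (2 * m) i j : ℤ) - thetaDistNe 1 (2 * k) (2 * m) (i + 1) j =
      if i + 1 < k then -1 else if i + 1 = k then (if j ≤ m then -1 else 0) else
      if i = k then (if j < m then 0 else 1) else 1 := by
    intro j hj
    have h1 : ∀ i, i ≤ 2 * k → (thetaDistNe 1 (2 * k) (2 * m) i j : ℤ) =
        if i < k then (if j ≤ m then (i : ℤ) + j else (i : ℤ) + (2 * m - j) + 1) else
        if i = k then (if j ≤ m then (k : ℤ) + j else (k : ℤ) + (2 * m - j)) else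
        (if j < m then (2 * k - i : ℤ) + j + 1 else (2 * k - i : ℤ) + (2 * m - j)) := by
      intro i hi
      unfold thetaDistNe
      split_ifs <;> omega
    rw [h1 i hi.le, h1 (i + 1) hi]
    split_ifs <;> omega
  have h1 := h j hj.le
  have h2 := h (j + 1) hj
  have e : ∀ a b c d : ℤ, a - b - c + d = a - b - (c - d) := by intros; ring
  rw [e, h1, h2]
  clear h h1 h2 e
  split_ifs <;> omega

end BookGraph

/-! ### The cyclic order of opposite edges, and θ(1, 2k, 2m). -/

section BookGraphCofSum

open Matrix

/-- The successor of the edge `i` in the cyclic order of the edges of the Hamiltonian cycle of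
`θ(1, 2k, 2m)` in which each edge is followed by an opposite edge. -/
def oppositeEdge (k m i : ℕ) : ℕ :=
  if i < 2 * k then (if k ≤ i then i - k else if i + 1 = k then 2 * k + m - 1 else i + k + 1)
  else (if i < 2 * k + m then i + m else if i = 2 * k + m then k else i - m - 1)

/-- The edge in place `s` of the cyclic order given by `oppositeEdge`. -/
def oppositeEdgeOrder (k m s : ℕ) : ℕ :=
  if s < 2 * k then (if s % 2 = 0 then k + s / 2 else s / 2)
  else (if s % 2 = 0 then 3 * k + m - 1 - s / 2 else 3 * k + 2 * m - 1 - s / 2)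

theorem oppositeEdgeOrder_lt {k m s : ℕ} (hs : s < 2 * k + 2 * m) :
    oppositeEdgeOrder k m s < 2 * k + 2 * m := by
  unfold oppositeEdgeOrder; split_ifs <;> omega

theorem oppositeEdgeOrder_injOn {k m s t : ℕ} (hs : s < 2 * k + 2 * m) (ht : t < 2 * k + 2 * m)
    (h : oppositeEdgeOrder k m s = oppositeEdgeOrder k m t) : s = t := by
  unfold oppositeEdgeOrder at h; split_ifs at h <;> omega

theorem oppositeEdge_oppositeEdgeOrder {k m s : ℕ} (hk : 1 ≤ k) (hm : 1 ≤ m)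
    (hs : s < 2 * k + 2 * m) : oppositeEdge k m (oppositeEdgeOrder k m s) =
      oppositeEdgeOrder k m (if s + 1 = 2 * k + 2 * m then 0 else s + 1) := by
  have : ∀ s t, s < 2 * k + 2 * m → t = (if s + 1 = 2 * k + 2 * m then 0 else s + 1) →
      oppositeEdge k m (oppositeEdgeOrder k m s) = oppositeEdgeOrder k m t := by
    intro s t hs ht
    have h1 : (oppositeEdgeOrder k m s = if s < 2 * k then (if s % 2 = 0 then k + s / 2 else s / 2)
      else (if s % 2 = 0 then 3 * k + m - 1 - s / 2 else 3 * k + 2 * m - 1 - s / 2)) := rfl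
    generalize oppositeEdgeOrder k m s = x at *
    unfold oppositeEdge oppositeEdgeOrder
    split_ifs at * <;> omega
  exact this s _ hs rfl

theorem fin_val_add_one {n : ℕ} [NeZero n] (s : Fin n) :
    ((s + 1 : Fin n) : ℕ) = if (s : ℕ) + 1 = n then 0 else (s : ℕ) + 1 := by
  obtain ⟨m, rfl⟩ := Nat.exists_eq_succ_of_ne_zero (NeZero.ne n)
  rw [Fin.val_add_one]
  simp [Fin.ext_iff]

theorem oppositeEdge_eq_iff_of_lt_of_lt {k m i j : ℕ} (hi : i < 2 * k) (hj : j < 2 * k)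
    (hm : 1 ≤ m) : oppositeEdge k m i = j ↔ i = j + k ∨ j = i + k + 1 := by
  unfold oppositeEdge; split_ifs <;> omega

theorem oppositeEdge_eq_iff_of_lt_of_ge {k m i y : ℕ} (hi : i < 2 * k) (hy : y < 2 * m) :
    oppositeEdge k m i = 2 * k + 2 * m - (y + 1) ↔ i + 1 = k ∧ y = m := by
  unfold oppositeEdge; split_ifs <;> omega

theorem oppositeEdge_eq_iff_of_ge_of_lt {k m i y : ℕ} (hi : i < 2 * k) (hy : y < 2 * m) :
    oppositeEdge k m (2 * k + 2 * m - (y + 1)) = i ↔ i = k ∧ y + 1 = m := by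
  unfold oppositeEdge; split_ifs <;> omega

theorem oppositeEdge_eq_iff_of_ge_of_ge {k m y z : ℕ} (hk : 1 ≤ k) (hy : y < 2 * m)
    (hz : z < 2 * m) : oppositeEdge k m (2 * k + 2 * m - (y + 1)) = 2 * k + 2 * m - (z + 1) ↔
      y = z + m ∨ z = y + m + 1 := by
  unfold oppositeEdge; split_ifs <;> omega

theorem exists_oppositeEdge_perm {k m : ℕ} (hk : 1 ≤ k) (hm : 1 ≤ m) [NeZero (2 * k + 2 * m)] :
    ∃ (π : Equiv.Perm (Fin (2 * k + 2 * m))) (τ : Fin (2 * k + 2 * m) ≃ Fin (2 * k + 2 * m)),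
      (∀ s, π (τ s) = τ (s + 1)) ∧ ∀ i, (π i : ℕ) = oppositeEdge k m i := by
  let f : Fin (2 * k + 2 * m) → Fin (2 * k + 2 * m) := fun s => ⟨_, oppositeEdgeOrder_lt s.2⟩
  have hf : Function.Injective f := fun s t h =>
    Fin.ext (oppositeEdgeOrder_injOn s.2 t.2 (Fin.ext_iff.mp h))
  let τ := Equiv.ofBijective f (Finite.injective_iff_bijective.mp hf)
  have hτ : ∀ s, (τ s : ℕ) = oppositeEdgeOrder k m s := fun s => rfl
  refine ⟨(τ.symm.trans (finRotate _)).trans τ, τ, fun s => by simp, fun i => ?_⟩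
  obtain ⟨s, rfl⟩ := τ.surjective i
  simp only [Equiv.trans_apply, Equiv.symm_apply_apply, finRotate_apply, hτ]
  rw [oppositeEdge_oppositeEdgeOrder hk hm s.2, fin_val_add_one]

/-- The vertices of `θ(1, p, q)` along its Hamiltonian cycle. -/
def thetaHamiltonian (p q i : ℕ) : ThetaVertex 1 p q :=
  if i ≤ p then thetaAt 1 p q 1 i else thetaAt 1 p q 2 (p + q - i)

theorem thetaHamiltonian_of_le {p q i : ℕ} (hp : 1 ≤ p) (hq : 1 ≤ q) (hi : p ≤ i) :
    thetaHamiltonian p q i = thetaAt 1 p q 2 (p + q - i) := by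
  rcases hi.eq_or_lt with rfl | h
  · rw [thetaHamiltonian, if_pos le_rfl, Nat.add_sub_cancel_left]
    exact (thetaAt_len (l := 1) (p := p) (q := q) (i := 1) hp).trans
      (thetaAt_len (l := 1) (p := p) (q := q) (i := 2) hq).symm
  · rw [thetaHamiltonian, if_neg (by omega)]

theorem one_le_thetaLen {l p q : ℕ} (hl : 1 ≤ l) (hp : 1 ≤ p) (hq : 1 ≤ q) (i : Fin 3) :
    1 ≤ thetaLen l p q i := by
  fin_cases i <;> assumption

theorem thetaHamiltonian_injOn {p q i j : ℕ} (hp : 1 ≤ p) (hq : 1 ≤ q) (hi : i < p + q)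
    (hj : j < p + q) (h : thetaHamiltonian p q i = thetaHamiltonian p q j) : i = j := by
  have h1 := one_le_thetaLen le_rfl hp hq
  have e1 : thetaLen 1 p q 1 = p := rfl
  have e2 : thetaLen 1 p q 2 = q := rfl
  unfold thetaHamiltonian at h
  split_ifs at h <;> rw [thetaAt_eq_iff h1 (by omega) (by omega)] at h <;>
    simp [e1, e2] at h <;> omega

theorem card_thetaVertex {l p q : ℕ} :
    Fintype.card (ThetaVertex l p q) = 2 + ((l - 1) + (p - 1) + (q - 1)) := by
  rw [Fintype.card_sum, Fintype.card_sigma, Fin.sum_univ_three]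
  simp only [Fintype.card_fin]
  rfl

theorem cofSum_thetaGraph_one {k m : ℕ} (hk : 1 ≤ k) (hm : 1 ≤ m) :
    cofSum (distMatrix (thetaGraph 1 (2 * k) (2 * m))) = -(2 * k + 2 * m) := by
  have : NeZero (2 * k + 2 * m) := ⟨by omega⟩
  obtain ⟨π, τ, hπτ, hπ⟩ := exists_oppositeEdge_perm hk hm
  have hp : 1 ≤ 2 * k := by omega
  have hq : 1 ≤ 2 * m := by omega
  let v : Fin (2 * k + 2 * m) → ThetaVertex 1 (2 * k) (2 * m) :=
    fun i => thetaHamiltonian (2 * k) (2 * m) i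
  have hv : Function.Bijective v := by
    rw [Fintype.bijective_iff_injective_and_card]
    refine ⟨fun i j h => Fin.ext (thetaHamiltonian_injOn hp hq i.2 j.2 h), ?_⟩
    rw [card_thetaVertex, Fintype.card_fin]; omega
  rw [← cofSum_submatrix_equiv _ (Equiv.ofBijective v hv),
    cofSum_of_cyclic_second_difference _ π τ hπτ]
  · rw [Odd.neg_one_pow ⟨k + m - 1, by omega⟩]; push_cast; ring
  intro i j
  have hsucc : ∀ i : Fin (2 * k + 2 * m), v (i + 1) = thetaHamiltonian (2 * k) (2 * m) (i + 1) := by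
    intro i
    simp only [v]
    rw [fin_val_add_one]
    split_ifs with h
    -- The index past the end is position 0 of the last path, which is the starting vertex.
    · rw [h, thetaHamiltonian_of_le (i := 2 * k + 2 * m) hp hq (by omega), Nat.sub_self]
      simp [thetaHamiltonian]
    · rfl
  suffices H : ∀ i j, i < 2 * k + 2 * m → j < 2 * k + 2 * m →
      distMatrix (thetaGraph 1 (2 * k) (2 * m)) (thetaHamiltonian (2 * k) (2 * m) i)
          (thetaHamiltonian (2 * k) (2 * m) j) -
        distMatrix (thetaGraph 1 (2 * k) (2 * m)) (thetaHamiltonian (2 * k) (2 * m) (i + 1))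
          (thetaHamiltonian (2 * k) (2 * m) j) -
        distMatrix (thetaGraph 1 (2 * k) (2 * m)) (thetaHamiltonian (2 * k) (2 * m) i)
          (thetaHamiltonian (2 * k) (2 * m) (j + 1)) +
        distMatrix (thetaGraph 1 (2 * k) (2 * m)) (thetaHamiltonian (2 * k) (2 * m) (i + 1))
          (thetaHamiltonian (2 * k) (2 * m) (j + 1)) =
      -2 * (if i = j then 1 else 0) + (if oppositeEdge k m i = j then 1 else 0) +
        if oppositeEdge k m j = i then 1 else 0 by
    have := H i j i.2 j.2
    simp only [← hπ, ← Fin.ext_iff, ← hsucc] at this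
    exact this
  clear i j hsucc hv
  intro i j hi hj
  have e1 : thetaLen 1 (2 * k) (2 * m) 1 = 2 * k := rfl
  have e2 : thetaLen 1 (2 * k) (2 * m) 2 = 2 * m := rfl
  have hs : ∀ i, thetaLen 1 (2 * k) (2 * m) 0 ≤ thetaLen 1 (2 * k) (2 * m) i :=
    one_le_thetaLen le_rfl hp hq
  have d11 : ∀ a b, a ≤ 2 * k → b ≤ 2 * k → distMatrix (thetaGraph 1 (2 * k) (2 * m))
      (thetaAt 1 (2 * k) (2 * m) 1 a) (thetaAt 1 (2 * k) (2 * m) 1 b) =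
      thetaDistEq 1 (2 * k) a b := fun a b ha hb =>
    congrArg Nat.cast (thetaGraph_dist le_rfl hs (i := 1) (j := 1) ha hb)
  have d12 : ∀ a b, a ≤ 2 * k → b ≤ 2 * m → distMatrix (thetaGraph 1 (2 * k) (2 * m))
      (thetaAt 1 (2 * k) (2 * m) 1 a) (thetaAt 1 (2 * k) (2 * m) 2 b) =
      thetaDistNe 1 (2 * k) (2 * m) a b := fun a b ha hb =>
    congrArg Nat.cast (thetaGraph_dist le_rfl hs (i := 1) (j := 2) ha hb)
  have d21 : ∀ a b, a ≤ 2 * m → b ≤ 2 * k → distMatrix (thetaGraph 1 (2 * k) (2 * m))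
      (thetaAt 1 (2 * k) (2 * m) 2 a) (thetaAt 1 (2 * k) (2 * m) 1 b) =
      thetaDistNe 1 (2 * m) (2 * k) a b := fun a b ha hb =>
    congrArg Nat.cast (thetaGraph_dist le_rfl hs (i := 2) (j := 1) ha hb)
  have d22 : ∀ a b, a ≤ 2 * m → b ≤ 2 * m → distMatrix (thetaGraph 1 (2 * k) (2 * m))
      (thetaAt 1 (2 * k) (2 * m) 2 a) (thetaAt 1 (2 * k) (2 * m) 2 b) =
      thetaDistEq 1 (2 * m) a b := fun a b ha hb =>
    congrArg Nat.cast (thetaGraph_dist le_rfl hs (i := 2) (j := 2) ha hb)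
  have p1 : ∀ i, i ≤ 2 * k → thetaHamiltonian (2 * k) (2 * m) i = thetaAt 1 (2 * k) (2 * m) 1 i :=
    fun i hi => if_pos hi
  have p2 : ∀ y, y ≤ 2 * m → thetaHamiltonian (2 * k) (2 * m) (2 * k + 2 * m - y) =
      thetaAt 1 (2 * k) (2 * m) 2 y := fun y hy => by
    rw [thetaHamiltonian_of_le hp hq (by omega)]; congr 1; omega
  -- The second half of the cycle runs down the last path, from position `y + 1` to `y`.
  have edge : ∀ i, 2 * k ≤ i → i < 2 * k + 2 * m → ∃ y, y < 2 * m ∧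
      i = 2 * k + 2 * m - (y + 1) ∧ i + 1 = 2 * k + 2 * m - y := fun i h1 h2 =>
    ⟨2 * k + 2 * m - 1 - i, by omega, by omega, by omega⟩
  rcases lt_or_ge i (2 * k) with hi' | hi' <;> rcases lt_or_ge j (2 * k) with hj' | hj'
  · have h := thetaDistEq_one_second_difference hi' hj'
    rw [p1 i hi'.le, p1 (i + 1) hi', p1 j hj'.le, p1 (j + 1) hj', d11 i j hi'.le hj'.le,
      d11 (i + 1) j hi' hj'.le, d11 i (j + 1) hi'.le hj', d11 (i + 1) (j + 1) hi' hj', h]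
    simp only [oppositeEdge_eq_iff_of_lt_of_lt, hi', hj', hm]
    clear * - hi' hj'
    split_ifs <;> omega
  · obtain ⟨y, hy, hy1, hy2⟩ := edge j hj' hj
    have h := thetaDistNe_one_second_difference hi' hy
    rw [p1 i hi'.le, p1 (i + 1) hi', hy2, p2 y hy.le, hy1, p2 (y + 1) hy, d12 i y hi'.le hy.le,
      d12 (i + 1) y hi' hy.le, d12 i (y + 1) hi'.le hy, d12 (i + 1) (y + 1) hi' hy]
    simp only [oppositeEdge_eq_iff_of_lt_of_ge hi' hy, oppositeEdge_eq_iff_of_ge_of_lt hi' hy]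
    have hne : i ≠ 2 * k + 2 * m - (y + 1) := by omega
    rw [if_neg hne]
    clear * - h
    split_ifs at * <;> omega
  · obtain ⟨y, hy, hy1, hy2⟩ := edge i hi' hi
    have h := thetaDistNe_one_second_difference hy hj'
    rw [p1 j hj'.le, p1 (j + 1) hj', hy2, p2 y hy.le, hy1, p2 (y + 1) hy, d21 y j hy.le hj'.le,
      d21 (y + 1) j hy hj'.le, d21 y (j + 1) hy.le hj', d21 (y + 1) (j + 1) hy hj']
    simp only [oppositeEdge_eq_iff_of_lt_of_ge hj' hy, oppositeEdge_eq_iff_of_ge_of_lt hj' hy]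
    have hne : 2 * k + 2 * m - (y + 1) ≠ j := by omega
    rw [if_neg hne]
    clear * - h
    split_ifs at * <;> omega
  · obtain ⟨y, hy, hy1, hy2⟩ := edge i hi' hi
    obtain ⟨z, hz, hz1, hz2⟩ := edge j hj' hj
    have h := thetaDistEq_one_second_difference hy hz
    rw [hz2, p2 z hz.le, hz1, p2 (z + 1) hz, hy2, p2 y hy.le, hy1, p2 (y + 1) hy,
      d22 y z hy.le hz.le, d22 (y + 1) z hy hz.le, d22 y (z + 1) hy.le hz, d22 (y + 1) (z + 1) hy hz]
    simp only [oppositeEdge_eq_iff_of_ge_of_ge hk hy hz, oppositeEdge_eq_iff_of_ge_of_ge hk hz hy]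
    clear * - hy hz h
    split_ifs at * <;> omega

end BookGraphCofSum

/-! ### Odd cycles with a doubled vertex. -/

section TwinCycle

open Matrix

/-- Evaluate 1ᵀ adj(XA) X1 in two ways: adj(X) X = det X gives the left side; the row shift replaces
adj(XA) by adj(Z), and X1 = -Zy gives the right. -/
theorem det_mul_cofSum {V : Type*} [Fintype V] [DecidableEq V] (X A Z : Matrix V V ℤ)
    (u y : V → ℤ) (h : ∀ i j, (X * A) i j = Z i j + u i) (hy : Z *ᵥ y = -(X *ᵥ 1)) :
    X.det * cofSum A = -(Z.det * ∑ i, y i) := by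
  have h1 : ((1 : V → ℤ) ᵥ* (X * A).adjugate) ⬝ᵥ (X *ᵥ 1) = X.det * cofSum A := by
    rw [adjugate_mul_distrib, ← vecMul_vecMul, ← dotProduct_mulVec, mulVec_mulVec, adjugate_mul,
      smul_mulVec, one_mulVec, dotProduct_smul, cofSum_eq_dotProduct, smul_eq_mul]
  rw [← h1, one_vecMul_adjugate_add_const Z (X * A) u h, ← one_vecMul_adjugate_dotProduct_mulVec,
    hy, dotProduct_neg, neg_neg]

/-- Adjugates of (1 - π)(1 + π) = 1 - π² show that adj(1 + π) fixes the all-ones vector, which 1 + π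
doubles. -/
theorem det_one_add_permMatrix {V : Type*} [Fintype V] [DecidableEq V] [Nonempty V]
    (π : Equiv.Perm V) (h1 : (1 - π.permMatrix ℤ).adjugate = of fun _ _ => 1)
    (h2 : (1 - (π * π).permMatrix ℤ).adjugate = of fun _ _ => 1) :
    (1 + π.permMatrix ℤ).det = 2 := by
  have hmul : (1 - π.permMatrix ℤ) * (1 + π.permMatrix ℤ) = 1 - (π * π).permMatrix ℤ := by
    rw [permMatrix_mul]; noncomm_ring
  have h3 : (1 + π.permMatrix ℤ).adjugate * (of fun _ _ => 1) = of fun _ _ => 1 := by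
    rw [← h1, ← adjugate_mul_distrib, hmul, h2, h1]
  obtain ⟨x⟩ := ‹Nonempty V›
  have h4 : ((1 + π.permMatrix ℤ).adjugate *ᵥ 1) x = 1 := congrFun (congrFun h3 x) x
  have h5 : (1 + π.permMatrix ℤ) *ᵥ (1 : V → ℤ) = (2 : ℤ) • 1 := by
    rw [add_mulVec, one_mulVec, permMatrix_mulVec]
    funext i; simp
  have h6 : ((1 + π.permMatrix ℤ).adjugate *ᵥ ((1 + π.permMatrix ℤ) *ᵥ (1 : V → ℤ))) x =
      (1 + π.permMatrix ℤ).det := by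
    rw [mulVec_mulVec, adjugate_mul, smul_mulVec, one_mulVec]; simp
  rw [← h6, h5, mulVec_smul, Pi.smul_apply, h4, smul_eq_mul, mul_one]

theorem exists_antipodal_perm (k : ℕ) : ∃ σ : Equiv.Perm (Fin (2 * k + 1)),
    (∀ i, (σ i : ℕ) = if (i : ℕ) ≤ k then i + k else i - k - 1) ∧
    (∀ i, (σ.symm i : ℕ) = if (i : ℕ) < k then i + k + 1 else i - k) ∧
    ((1 : Matrix (Fin (2 * k + 1)) (Fin (2 * k + 1)) ℤ) + σ.permMatrix ℤ).det = 2 := by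
  let σ : Equiv.Perm (Fin (2 * k + 1)) :=
    { toFun := fun i => ⟨if (i : ℕ) ≤ k then i + k else i - k - 1, by split_ifs <;> omega⟩
      invFun := fun i => ⟨if (i : ℕ) < k then i + k + 1 else i - k, by split_ifs <;> omega⟩
      left_inv := fun i => Fin.ext (by simp only; split_ifs <;> omega)
      right_inv := fun i => Fin.ext (by simp only; split_ifs <;> omega) }
  have hσ : ∀ i, (σ i : ℕ) = if (i : ℕ) ≤ k then i + k else i - k - 1 := fun _ => rfl
  refine ⟨σ, hσ, fun _ => rfl, det_one_add_permMatrix σ ?_ ?_⟩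
  -- `σ` is translation by `k` modulo `2 * k + 1`, and `f s` is `s * k` reduced. Its square is
  -- translation by -1.
  · let f : Fin (2 * k + 1) → Fin (2 * k + 1) := fun s =>
      ⟨if (s : ℕ) = 0 then 0 else if (s : ℕ) % 2 = 0 then 2 * k + 1 - s / 2 else k - s / 2,
        by split_ifs <;> omega⟩
    have hf : Function.Injective f := fun s t h => by
      have := Fin.ext_iff.mp h
      simp only [f] at this
      apply Fin.ext
      split_ifs at this <;> omega
    refine adjugate_one_sub_permMatrix σ
      (Equiv.ofBijective f (Finite.injective_iff_bijective.mp hf)) fun s => Fin.ext ?_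
    rw [hσ, Equiv.ofBijective_apply, Equiv.ofBijective_apply]
    simp only [f]
    have h1 := fin_val_add_one s
    have h2 := s.2
    generalize ((s + 1 : Fin (2 * k + 1)) : ℕ) = t at *
    split_ifs at * <;> omega
  · have : σ * σ = (finRotate (2 * k + 1))⁻¹ := by
      rw [eq_inv_iff_mul_eq_one]
      ext i
      simp only [Equiv.Perm.mul_apply, finRotate_apply, hσ, fin_val_add_one, Equiv.Perm.one_apply]
      have := i.2
      split_ifs <;> omega
    rw [this, ← transpose_permMatrix, ← transpose_one, ← transpose_sub, ← adjugate_transpose,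
      adjugate_one_sub_finRotate]
    rfl

/-- The distance matrix of a cycle of length `2k + 1`, with a nonadjacent twin of its last vertex
added. -/
def twinCycleMatrix (k : ℕ) : Matrix (Fin (2 * k + 1) ⊕ Unit) (Fin (2 * k + 1) ⊕ Unit) ℤ :=
  fromBlocks
    (of fun i j => ((min (i - j + (j - i)) (2 * k + 1 - (i - j + (j - i))) : ℕ) : ℤ))
    (of fun i _ => ((if (i : ℕ) = 2 * k then 2 else min (2 * k - i) (i + 1) : ℕ) : ℤ))
    (of fun _ i => ((if (i : ℕ) = 2 * k then 2 else min (2 * k - i) (i + 1) : ℕ) : ℤ))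
    0

/-- Here `x` and `y` are the vertices farthest from `i`. If `j ≠ i` is at distance d from `i`, they
are at distances k - d and k + 1 - d from `j` in some order; if `j = i`, both are at distance k. -/
theorem cycle_antipodal_sum {k i j x y : ℕ} (hi : i ≤ 2 * k) (hj : j ≤ 2 * k)
    (hx : x = if i ≤ k then i + k else i - k - 1) (hy : y = if i < k then i + k + 1 else i - k) :
    2 * min (i - j + (j - i)) (2 * k + 1 - (i - j + (j - i))) +
      min (x - j + (j - x)) (2 * k + 1 - (x - j + (j - x))) +
      min (y - j + (j - y)) (2 * k + 1 - (y - j + (j - y))) +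
      (if i = j then 1 else 0) = 2 * k + 1 := by
  have h : ∀ i, i ≤ 2 * k → min (i - j + (j - i)) (2 * k + 1 - (i - j + (j - i))) =
      if i + k < j then i + (2 * k - j) + 1 else if i ≤ j then j - i else
      if j + k < i then j + (2 * k - i) + 1 else i - j := by
    intro i hi
    split_ifs <;> omega
  rcases lt_trichotomy i k with hik | rfl | hik
  · rw [if_pos hik.le] at hx
    rw [if_pos hik] at hy
    subst hx hy
    rw [h _ hi, h _ (by omega), h _ (by omega)]
    clear h
    split_ifs <;> omega
  · rw [if_pos le_rfl] at hx
    rw [if_neg (lt_irrefl _)] at hy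
    subst hx hy
    rw [h _ hi, h _ (by omega), h _ (by omega)]
    clear h
    split_ifs <;> omega
  · rw [if_neg (by omega)] at hx hy
    obtain ⟨d, rfl⟩ := Nat.exists_eq_add_of_lt hik
    obtain rfl : x = d := by omega
    obtain rfl : y = x + 1 := by omega
    rw [h _ hi, h _ (by omega), h _ (by omega)]
    clear h
    split_ifs <;> omega

/-- The twin has the distances of vertex `2 * k`, except 2 instead of 0 to that vertex; this adds
the correction terms. -/
theorem cycle_twin_antipodal_sum {k i x y : ℕ} (hk : 1 ≤ k) (hi : i ≤ 2 * k)
    (hx : x = if i ≤ k then i + k else i - k - 1) (hy : y = if i < k then i + k + 1 else i - k) :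
    2 * (if i = 2 * k then 2 else min (2 * k - i) (i + 1)) +
      (if x = 2 * k then 2 else min (2 * k - x) (x + 1)) +
      (if y = 2 * k then 2 else min (2 * k - y) (y + 1)) =
    3 * (if i = 2 * k then 1 else 0) + 2 * (if x = 2 * k then 1 else 0) +
      2 * (if y = 2 * k then 1 else 0) + (2 * k + 1) := by
  rcases lt_trichotomy i k with hik | rfl | hik
  · rw [if_pos hik.le] at hx
    rw [if_pos hik] at hy
    subst hx hy
    split_ifs <;> omega
  · rw [if_pos le_rfl] at hx
    rw [if_neg (lt_irrefl _)] at hy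
    subst hx hy
    split_ifs <;> omega
  · rw [if_neg (by omega)] at hx hy
    obtain ⟨d, rfl⟩ := Nat.exists_eq_add_of_lt hik
    obtain rfl : x = d := by omega
    obtain rfl : y = x + 1 := by omega
    split_ifs <;> omega

theorem cofSum_twinCycleMatrix {k : ℕ} (hk : 1 ≤ k) :
    cofSum (twinCycleMatrix k) = 8 * k - 12 := by
  obtain ⟨σ, hσ, hσ', hdet⟩ := exists_antipodal_perm k
  set a : Fin (2 * k + 1) := Fin.last (2 * k) with ha
  have ha' : (a : ℕ) = 2 * k := rfl
  have haσ : σ a ≠ a := fun h => by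
    have := congrArg Fin.val h
    rw [hσ, ha'] at this; split_ifs at this <;> omega
  have haσ' : σ.symm a ≠ a := fun h => haσ (by conv_lhs => rw [← h]; simp)
  let Q : Matrix (Fin (2 * k + 1)) (Fin (2 * k + 1)) ℤ :=
    (1 + σ.permMatrix ℤ) * (1 + (σ.permMatrix ℤ)ᵀ)
  have hQdet : Q.det = 4 := by
    have : (1 + (σ.permMatrix ℤ)ᵀ).det = 2 := by
      rw [← transpose_one, ← transpose_add, det_transpose, hdet]
    rw [det_mul, hdet, this]; norm_num
  have hQmul : ∀ (f : Fin (2 * k + 1) → ℤ) i, (Q *ᵥ f) i = 2 * f i + f (σ i) + f (σ.symm i) := by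
    intro f i
    rw [← mulVec_mulVec, transpose_permMatrix, add_mulVec, add_mulVec, one_mulVec, one_mulVec,
      permMatrix_mulVec, permMatrix_mulVec]
    simp [Equiv.Perm.inv_def]
    ring
  let w : Fin (2 * k + 1) → ℤ := fun i =>
    3 * (if i = a then 1 else 0) + 2 * (if σ i = a then 1 else 0) +
      2 * (if σ.symm i = a then 1 else 0)
  have hwa : w a = 3 := by simp [w, haσ, haσ']
  have hwsum : ∑ i, w i = 7 := by
    have e1 : ∑ i, (if σ i = a then (1 : ℤ) else 0) = 1 := by
      rw [Equiv.sum_comp σ (fun i => if i = a then (1 : ℤ) else 0)]; simp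
    have e2 : ∑ i, (if σ.symm i = a then (1 : ℤ) else 0) = 1 := by
      rw [Equiv.sum_comp σ.symm (fun i => if i = a then (1 : ℤ) else 0)]; simp
    simp only [w, Finset.sum_add_distrib, ← Finset.mul_sum, e1, e2]
    simp
  -- `Q` applies the antipodal identity to the cycle rows; the last row subtracts the row of `a`
  -- from that of its twin.
  let X : Matrix (Fin (2 * k + 1) ⊕ Unit) (Fin (2 * k + 1) ⊕ Unit) ℤ :=
    fromBlocks Q 0 (replicateRow Unit (Pi.single a (-1))) 1
  let Z : Matrix (Fin (2 * k + 1) ⊕ Unit) (Fin (2 * k + 1) ⊕ Unit) ℤ :=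
    -fromBlocks 1 (replicateCol Unit (-w)) (replicateRow Unit (Pi.single a (-2))) (of fun _ _ => 2)
  have hXdet : X.det = 4 := by rw [det_fromBlocks_zero₁₂, hQdet]; simp
  have hZdet : Z.det = -4 := by
    rw [det_neg, det_fromBlocks_one₁₁, Even.neg_one_pow ⟨k + 1, by simp; ring⟩, det_unique]
    simp [mul_apply, Pi.single_apply, hwa]
  -- The vector solves Zy = -X1 = (-4, 0); its sum is 4(2k + 1) - 2·7 - 2 = 8k - 12.
  have key := det_mul_cofSum X (twinCycleMatrix k) Z
    (Sum.elim (fun _ => 2 * k + 1) 0) (Sum.elim (fun i => 4 - 2 * w i) (fun _ => -2)) ?_ ?_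
  · rw [hXdet, hZdet, Fintype.sum_sum_type] at key
    simp only [Sum.elim_inl, Sum.elim_inr, Finset.sum_sub_distrib, ← Finset.mul_sum, hwsum] at key
    simp at key
    linarith
  · have hX1 : ∀ i j, (X * twinCycleMatrix k) (Sum.inl i) j =
        (Q *ᵥ fun l => twinCycleMatrix k (Sum.inl l) j) i := by
      intro i j
      simp [mul_apply, X, Fintype.sum_sum_type, mulVec, dotProduct]
    have hX2 : ∀ j, (X * twinCycleMatrix k) (Sum.inr ()) j =
        twinCycleMatrix k (Sum.inr ()) j - twinCycleMatrix k (Sum.inl a) j := by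
      intro j
      simp [mul_apply, X, Fintype.sum_sum_type, Pi.single_apply]
      ring
    rintro (i | ⟨⟩) (j | ⟨⟩)
    · rw [hX1, hQmul]
      have h := congrArg (Nat.cast : ℕ → ℤ)
        (cycle_antipodal_sum (Nat.le_of_lt_succ i.2) (Nat.le_of_lt_succ j.2) (hσ i) (hσ' i))
      simp only [twinCycleMatrix, fromBlocks_apply₁₁, of_apply, Z, Matrix.neg_apply, one_apply,
        Sum.elim_inl, Fin.ext_iff]
      simp only [Nat.cast_add, Nat.cast_mul, Nat.cast_ofNat, Nat.cast_one, Nat.cast_ite,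
        Nat.cast_zero] at h
      linarith
    · rw [hX1, hQmul]
      have h := congrArg (Nat.cast : ℕ → ℤ)
        (cycle_twin_antipodal_sum hk (Nat.le_of_lt_succ i.2) (hσ i) (hσ' i))
      simp only [twinCycleMatrix, fromBlocks_apply₁₂, of_apply, Z, Matrix.neg_apply,
        Sum.elim_inl, replicateCol_apply, Pi.neg_apply, w, Fin.ext_iff, ha', neg_neg]
      simp only [Nat.cast_add, Nat.cast_mul, Nat.cast_ofNat, Nat.cast_one, Nat.cast_ite,
        Nat.cast_zero] at h ⊢
      linarith
    · rw [hX2]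
      simp only [twinCycleMatrix, fromBlocks_apply₁₁, fromBlocks_apply₂₁, of_apply, Z,
        Matrix.neg_apply, Sum.elim_inr, Pi.zero_apply, replicateRow_apply, Pi.single_apply,
        Fin.ext_iff, ha']
      have := j.2
      split_ifs <;> omega
    · rw [hX2]
      simp [twinCycleMatrix, Z, ha']
  · have hone : (1 : Fin (2 * k + 1) ⊕ Unit → ℤ) = Sum.elim (fun _ => 1) (fun _ => 1) := by
      funext x; rcases x with x | x <;> rfl
    rw [hone]
    simp only [X, Z, neg_mulVec, fromBlocks_mulVec, Sum.elim_comp_inl, Sum.elim_comp_inr]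
    congr 1
    funext x
    rcases x with i | ⟨⟩
    · simp only [Sum.elim_inl, Pi.add_apply, hQmul, one_mulVec, zero_mulVec]
      simp [mulVec, dotProduct]
      ring
    · simp [mulVec, dotProduct, Pi.single_apply, hwa]

end TwinCycle

/-! ### The graphs θ(2, 2, q) with q odd, and θ(2, 2, 2). -/

section TwinTheta

open Matrix

/-- The vertices of `θ(2, 2, q)`, as a cycle of length `2k + 1 = q + 2` with a twin of its last
vertex. -/
def thetaTwinVertex (q k : ℕ) : Fin (2 * k + 1) ⊕ Unit → ThetaVertex 2 2 q
  | Sum.inl i => if (i : ℕ) = 2 * k then thetaAt 2 2 q 0 1 else thetaAt 2 2 q 2 i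
  | Sum.inr _ => thetaAt 2 2 q 1 1

theorem cofSum_thetaGraph_two_two {q k : ℕ} (hk : 2 ≤ k) (hq : q + 1 = 2 * k) :
    cofSum (distMatrix (thetaGraph 2 2 q)) = 8 * k - 12 := by
  have h1 := one_le_thetaLen (l := 2) (p := 2) (q := q) (by omega) (by omega) (by omega)
  have e0 : thetaLen 2 2 q 0 = 2 := rfl
  have e1 : thetaLen 2 2 q 1 = 2 := rfl
  have e2 : thetaLen 2 2 q 2 = q := rfl
  have hs : ∀ i, thetaLen 2 2 q 0 ≤ thetaLen 2 2 q i := by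
    intro i
    fin_cases i
    · exact le_rfl
    · exact le_rfl
    · exact (show 2 ≤ q by omega)
  have hinj : Function.Injective (thetaTwinVertex q k) := by
    rintro (i | ⟨⟩) (j | ⟨⟩) h
    · have := i.2
      have := j.2
      congr 1
      apply Fin.ext
      simp only [thetaTwinVertex] at h
      split_ifs at h <;> (try rw [thetaAt_eq_iff h1 (by omega) (by omega)] at h) <;>
        simp [e0, e2] at h <;> omega
    · have := i.2
      simp only [thetaTwinVertex] at h
      split_ifs at h <;> rw [thetaAt_eq_iff h1 (by omega) (by omega)] at h <;>
        simp [e0, e1, e2] at h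
    · have := j.2
      simp only [thetaTwinVertex] at h
      split_ifs at h <;> rw [thetaAt_eq_iff h1 (by omega) (by omega)] at h <;>
        simp [e0, e1, e2] at h
    · rfl
  have hbij : Function.Bijective (thetaTwinVertex q k) := by
    rw [Fintype.bijective_iff_injective_and_card]
    refine ⟨hinj, ?_⟩
    rw [card_thetaVertex, Fintype.card_sum, Fintype.card_fin, Fintype.card_unit]
    omega
  rw [← cofSum_submatrix_equiv _ (Equiv.ofBijective _ hbij),
    ← cofSum_twinCycleMatrix (by omega : 1 ≤ k)]
  congr 1
  ext x y
  simp only [submatrix_apply, Equiv.ofBijective_apply, distMatrix, of_apply]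
  have h0 : 1 ≤ thetaLen 2 2 q 0 := by omega
  rcases x with i | ⟨⟩ <;> rcases y with j | ⟨⟩
  · have := i.2
    have := j.2
    simp only [thetaTwinVertex, twinCycleMatrix, fromBlocks_apply₁₁, of_apply]
    congr 1
    split_ifs <;> rw [thetaGraph_dist h0 hs (by omega) (by omega)] <;>
      simp [e0, e2, thetaDistEq, thetaDistNe] <;> omega
  · have := i.2
    simp only [thetaTwinVertex, twinCycleMatrix, fromBlocks_apply₁₂, of_apply]
    congr 1
    split_ifs
    · rw [thetaGraph_dist h0 hs (by omega) (by omega)]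
      simp [e0, e1, thetaDistNe]
    · rw [thetaGraph_dist h0 hs (by omega) (by omega)]
      simp [e0, e1, e2, thetaDistNe]
      omega
  · have := j.2
    simp only [thetaTwinVertex, twinCycleMatrix, fromBlocks_apply₂₁, of_apply]
    congr 1
    split_ifs
    · rw [thetaGraph_dist h0 hs (by omega) (by omega)]
      simp [e0, e1, thetaDistNe]
    · rw [thetaGraph_dist h0 hs (by omega) (by omega)]
      simp [e0, e1, e2, thetaDistNe]
      omega
  · simp [twinCycleMatrix]

theorem cofSum_thetaGraph_two_two_two : cofSum (distMatrix (thetaGraph 2 2 2)) = -16 := by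
  have h1 := one_le_thetaLen (l := 2) (p := 2) (q := 2) (by omega) (by omega) (by omega)
  have e : ∀ i, thetaLen 2 2 2 i = 2 := by intro i; fin_cases i <;> rfl
  have hs : ∀ i, thetaLen 2 2 2 0 ≤ thetaLen 2 2 2 i := by simp [e]
  let v : Fin 5 → ThetaVertex 2 2 2 := ![thetaAt 2 2 2 0 0, thetaAt 2 2 2 0 2, thetaAt 2 2 2 0 1,
    thetaAt 2 2 2 1 1, thetaAt 2 2 2 2 1]
  have hv : Function.Bijective v := by
    rw [Fintype.bijective_iff_injective_and_card]
    refine ⟨?_, by rw [card_thetaVertex, Fintype.card_fin]⟩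
    intro i j h
    fin_cases i <;> fin_cases j <;> first | rfl | skip
    all_goals
      exfalso
      simp only [v] at h
      simp [-thetaAt_zero] at h
      rw [thetaAt_eq_iff h1 (by simp [e]) (by simp [e])] at h
      simp [e] at h
  have hM : (distMatrix (thetaGraph 2 2 2)).submatrix v v =
      !![0, 2, 1, 1, 1; 2, 0, 1, 1, 1; 1, 1, 0, 2, 2; 1, 1, 2, 0, 2; 1, 1, 2, 2, 0] := by
    ext i j
    simp only [submatrix_apply, distMatrix, of_apply]
    fin_cases i <;> fin_cases j <;> simp only [v] <;>
      simp [-thetaAt_zero, -SimpleGraph.dist_eq_one_iff_adj] <;>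
      rw [thetaGraph_dist (i₀ := 0) (by simp [e]) hs (by simp [e]) (by simp [e])] <;>
      simp [e, thetaDistEq, thetaDistNe]
  have hdet : (!![0, 2, 1, 1, 1; 2, 0, 1, 1, 1; 1, 1, 0, 2, 2; 1, 1, 2, 0, 2; 1, 1, 2, 2, 0] :
      Matrix (Fin 5) (Fin 5) ℤ).det = -16 := by
    decide +kernel
  rw [← cofSum_submatrix_equiv _ (Equiv.ofBijective v hv)]
  -- The indicator of the two branch vertices is mapped to the constant 2, so twice the cofactor sum
  -- is twice the determinant.
  have h2 := one_vecMul_adjugate_dotProduct_mulVec ((distMatrix (thetaGraph 2 2 2)).submatrix v v)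
    ![1, 1, 0, 0, 0]
  have h3 : (distMatrix (thetaGraph 2 2 2)).submatrix v v *ᵥ ![1, 1, 0, 0, 0] = (2 : ℤ) • 1 := by
    rw [hM]; decide +kernel
  rw [h3, dotProduct_smul, ← cofSum_eq_dotProduct, hM, hdet] at h2
  simp [Fin.sum_univ_succ] at h2
  rw [Equiv.coe_ofBijective, hM]
  omega

end TwinTheta

/-! ### Sorting the lengths and choosing a pair of paths. -/

section Classification

theorem exists_sorted_thetaGraph {l p q : ℕ} (hl : 1 ≤ l) (hp : 2 ≤ p) (hq : 2 ≤ q) :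
    ∃ l' p' q', 1 ≤ l' ∧ l' ≤ p' ∧ p' ≤ q' ∧ 2 ≤ p' ∧
      Nonempty (thetaGraph l p q ≃g thetaGraph l' p' q') := by
  have s01 : ∀ l p q, Nonempty (thetaGraph l p q ≃g thetaGraph p l q) := fun l p q =>
    thetaGraph_iso_of_perm (Equiv.swap 0 1) fun i => by fin_cases i <;> rfl
  have s12 : ∀ l p q, Nonempty (thetaGraph l p q ≃g thetaGraph l q p) := fun l p q =>
    thetaGraph_iso_of_perm (Equiv.swap 1 2) fun i => by fin_cases i <;> rfl
  obtain ⟨f1⟩ := s01 l p q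
  obtain ⟨f2⟩ := s12 l p q
  obtain ⟨f3⟩ := s12 p l q
  obtain ⟨f4⟩ := s01 l q p
  obtain ⟨f5⟩ := s12 q l p
  rcases le_total l p with h1 | h1 <;> rcases le_total p q with h2 | h2 <;>
    rcases le_total l q with h3 | h3
  · exact ⟨l, p, q, hl, h1, h2, hp, ⟨SimpleGraph.Iso.refl⟩⟩
  · exact ⟨l, p, q, hl, h1, h2, hp, ⟨SimpleGraph.Iso.refl⟩⟩
  · exact ⟨l, q, p, hl, h3, h2, hq, ⟨f2⟩⟩
  · exact ⟨q, l, p, by omega, h3, h1, by omega, ⟨f2.trans f4⟩⟩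
  · exact ⟨p, l, q, by omega, h1, h3, by omega, ⟨f1⟩⟩
  · exact ⟨p, q, l, by omega, h2, h3, hq, ⟨f1.trans f3⟩⟩
  · exact ⟨q, p, l, by omega, h2, h1, hp, by
      obtain ⟨g⟩ := s12 q l p
      exact ⟨(f2.trans f4).trans g⟩⟩
  · exact ⟨q, p, l, by omega, h2, h1, hp, ⟨(f2.trans f4).trans f5⟩⟩

theorem cofSum_thetaGraph_eq_zero_of_sorted {l p q : ℕ} (hl : 1 ≤ l) (hlp : l ≤ p) (hpq : p ≤ q)
    (hp : 2 ≤ p) (h1 : ¬ (l = 1 ∧ Even p ∧ Even q)) (h2 : ¬ (l = 2 ∧ p = 2 ∧ q = 2))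
    (h3 : ¬ (l = 2 ∧ p = 2 ∧ Odd q)) : cofSum (distMatrix (thetaGraph l p q)) = 0 := by
  rw [Nat.even_iff, Nat.even_iff] at h1
  rw [Nat.odd_iff] at h3
  have e0 : thetaLen l p q 0 = l := rfl
  have e1 : thetaLen l p q 1 = p := rfl
  have e2 : thetaLen l p q 2 = q := rfl
  have hs : ∀ i, thetaLen l p q 0 ≤ thetaLen l p q i := by
    intro i
    fin_cases i
    · exact le_rfl
    · exact hlp
    · exact hlp.trans hpq
  by_cases hc1 : l % 2 = p % 2 ∧ 3 ≤ p
  · exact cofSum_thetaGraph_eq_zero_of_parity (i₀ := 0) (i := 0) (j := 1) hl hs (by decide) hc1.1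
      (by omega) (by omega)
  · by_cases hc2 : l % 2 = q % 2
    · exact cofSum_thetaGraph_eq_zero_of_parity (i₀ := 0) (i := 0) (j := 2) hl hs (by decide) hc2
        (by omega) (by omega)
    -- If `l` and `p` had equal parity, then `l = p = 2` with `q` odd, which is excluded. So `p` and
    -- `q` agree in parity; if both are even, `l` is odd and not 1.
    · exact cofSum_thetaGraph_eq_zero_of_parity (i₀ := 0) (i := 1) (j := 2) hl hs (by decide)
        (by omega) (by omega) (by omega)

end Classification

theorem mainTheorem4 {V : Type*} [Fintype V] [DecidableEq V] (G : SimpleGraph V) :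
    (∀ p q : ℕ, 2 ≤ p → 2 ≤ q → Even p → Even q → Nonempty (G ≃g thetaGraph 1 p q) →
      cofSum (distMatrix G) = -((p : ℤ) + (q : ℤ))) ∧
    (Nonempty (G ≃g thetaGraph 2 2 2) → cofSum (distMatrix G) = -16) ∧
    (∀ q : ℕ, 1 < q → Odd q → Nonempty (G ≃g thetaGraph 2 2 q) →
      cofSum (distMatrix G) = 4 * (q : ℤ) - 8) ∧
    (∀ l p q : ℕ, 1 ≤ l → 2 ≤ p → 2 ≤ q → Nonempty (G ≃g thetaGraph l p q) →
      (¬ ∃ p' q' : ℕ, 2 ≤ p' ∧ 2 ≤ q' ∧ Even p' ∧ Even q' ∧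
        Nonempty (G ≃g thetaGraph 1 p' q')) →
      (¬ Nonempty (G ≃g thetaGraph 2 2 2)) →
      (¬ ∃ q' : ℕ, 1 < q' ∧ Odd q' ∧ Nonempty (G ≃g thetaGraph 2 2 q')) →
      cofSum (distMatrix G) = 0) := by
  have hcof : ∀ {l p q : ℕ}, 1 ≤ l → 1 ≤ p → 1 ≤ q → (G ≃g thetaGraph l p q) →
      cofSum (distMatrix G) = cofSum (distMatrix (thetaGraph l p q)) := fun hl hp hq f =>
    cofSum_distMatrix_of_iso f (thetaGraph_connected (one_le_thetaLen hl hp hq))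
  refine ⟨?_, ?_, ?_, ?_⟩
  · rintro p q hp hq hpe hqe ⟨f⟩
    obtain ⟨k, rfl⟩ := hpe.two_dvd
    obtain ⟨m, rfl⟩ := hqe.two_dvd
    rw [hcof le_rfl (by omega) (by omega) f, cofSum_thetaGraph_one (by omega) (by omega)]
    push_cast; ring
  · rintro ⟨f⟩
    rw [hcof (by omega) (by omega) (by omega) f, cofSum_thetaGraph_two_two_two]
  · rintro q hq ⟨k, rfl⟩ ⟨f⟩
    rw [hcof (by omega) (by omega) (by omega) f,
      cofSum_thetaGraph_two_two (k := k + 1) (by omega) (by omega)]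
    push_cast; ring
  · rintro l p q hl hp hq ⟨f⟩ h1 h2 h3
    obtain ⟨l', p', q', hl', hlp, hpq, hp', ⟨g⟩⟩ := exists_sorted_thetaGraph hl hp hq
    rw [hcof hl' (by omega) (by omega) (f.trans g)]
    -- A sorted triple in an exceptional family would make `G` itself isomorphic to a listed graph.
    refine cofSum_thetaGraph_eq_zero_of_sorted hl' hlp hpq hp' ?_ ?_ ?_
    · rintro ⟨rfl, hpe, hqe⟩
      exact h1 ⟨p', q', hp', hp'.trans hpq, hpe, hqe, ⟨f.trans g⟩⟩
    · rintro ⟨rfl, rfl, rfl⟩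
      exact h2 ⟨f.trans g⟩
    · rintro ⟨rfl, rfl, hqo⟩
      exact h3 ⟨q', hpq, hqo, ⟨f.trans g⟩⟩
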